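/- Let $H^2$ be the Hardy space of the open unit disk $\mathbb{D}$: the analytic functions $f(z)=\sum_{n\ge 0}a_nz^n$ on $\mathbb{D}$ whose integral means $\int_{\mathbb{T}}|f(r\zeta)|^2\,dm(\zeta)$ ($m$ the normalized arc length on the unit circle $\mathbb{T}$) stay bounded for $0<r<1$, a Hilbert space with $\langle f,g\rangle=\sum_{n\ge0}a_n\overline{b_n}$ for $g(z)=\sum_{n\ge 0}b_nz^n$. Let $(\lambda_n)$ be a finite or infinite sequence of distinct points of $\mathbb{D}$ with $\sum_n(1-|\lambda_n|)<\infty$, and let $u$ be a Blaschke product with simple zeros $\lambda_1,\lambda_2,\ldots$, i.e. $$u(z)=c\prod_n b_{\lambda_n}(z),\qquad |c|=1,\qquad b_\lambda(z)=\frac{|\lambda|}{\lambda}\,\frac{\lambda-z}{1-\overline{\lambda}z}\ (\lambda\ne0),\qquad b_0(z)=z .$$ Let $\mathcal{K}_u=(uH^2)^{\perp}$ be the orthogonal complement of $uH^2$ in $H^2$, and let $k_\lambda(z)=\dfrac{1-\overline{u(\lambda)}u(z)}{1-\overline{\lambda}z}$ be its reproducing kernel at $\lambda\in\mathbb{D}$.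 Then: 1. for every $n$, $k_{\lambda_n}(z)=\dfrac{1}{1-\overline{\lambda_n}z}$ for all $z\in\mathbb{D}$, that is, $k_{\lambda_n}$ is the Cauchy kernel at $\lambda_n$; 2. the closed linear span in $H^2$ of $\{k_{\lambda_1},k_{\lambda_2},\ldots\}$ equals $\mathcal{K}_u$; 3. $\mathcal{K}_u$ contains a dense subset each of whose elements extends continuously to the closed disk $\mathbb{D}^-$ and has an infinitely differentiable boundary function on $\mathbb{T}$. -/

import Mathlib

open scoped ComplexConjugate ContDiff Manifold InnerProductSpace Topology

namespace ModelSpace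

open Complex

noncomputable section

/-- The extension by zero to `ℂ` of a function on the open unit disk. -/
def discExtend (f : UnitDisc → ℂ) (z : ℂ) : ℂ :=
  if hz : ‖z‖ < 1 then f (UnitDisc.mk z hz) else 0

/-- `f` is analytic on the open unit disk. -/
def IsDiscAnalytic (f : UnitDisc → ℂ) : Prop :=
  DifferentiableOn ℂ (discExtend f) (Metric.ball 0 1)

/-- The integral mean `∫_𝕋 |f (r ζ)|² dm(ζ)`, with `m` the normalized arc length on the circle. -/
def integralMean (f : UnitDisc → ℂ) (r : ℝ) : ℝ :=
  Real.circleAverage (fun z => ‖discExtend f z‖ ^ 2) 0 r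

/-- The `n`-th Taylor coefficient of `f` at the origin. -/
def taylorCoeff (f : UnitDisc → ℂ) (n : ℕ) : ℂ :=
  (n.factorial : ℂ)⁻¹ * iteratedDeriv n (discExtend f) 0

theorem discExtend_coe (f : UnitDisc → ℂ) (z : UnitDisc) : discExtend f z = f z := by
  simp [discExtend, z.norm_lt_one]

theorem discExtend_of_lt (f : UnitDisc → ℂ) {z : ℂ} (hz : ‖z‖ < 1) :
    discExtend f z = f (UnitDisc.mk z hz) := by
  simp [discExtend, hz]

theorem discExtend_add (f g : UnitDisc → ℂ) :
    discExtend (f + g) = discExtend f + discExtend g := by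
  ext z; by_cases hz : ‖z‖ < 1 <;> simp [discExtend, hz]

theorem discExtend_smul (c : ℂ) (f : UnitDisc → ℂ) :
    discExtend (c • f) = c • discExtend f := by
  ext z; by_cases hz : ‖z‖ < 1 <;> simp [discExtend, hz]

theorem discExtend_zero : discExtend 0 = 0 := by
  ext z; simp [discExtend]

theorem IsDiscAnalytic.continuous_circleMap {f : UnitDisc → ℂ} (hf : IsDiscAnalytic f) {r : ℝ}
    (hr : r ∈ Set.Ioo (0 : ℝ) 1) : Continuous fun θ : ℝ => discExtend f (circleMap 0 r θ) := by
  refine ContinuousOn.comp_continuous (DifferentiableOn.continuousOn hf)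
    (_root_.continuous_circleMap 0 r) fun θ => ?_
  simp [abs_of_pos hr.1, hr.2]

theorem IsDiscAnalytic.circleIntegrable_sq {f : UnitDisc → ℂ} (hf : IsDiscAnalytic f) {r : ℝ}
    (hr : r ∈ Set.Ioo (0 : ℝ) 1) :
    CircleIntegrable (fun z => ‖discExtend f z‖ ^ 2) 0 r :=
  ((hf.continuous_circleMap hr).norm.pow 2).intervalIntegrable _ _

theorem IsDiscAnalytic.add {f g : UnitDisc → ℂ} (hf : IsDiscAnalytic f) (hg : IsDiscAnalytic g) :
    IsDiscAnalytic (f + g) := by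
  unfold IsDiscAnalytic
  rw [discExtend_add]
  exact DifferentiableOn.add hf hg

theorem IsDiscAnalytic.smul {f : UnitDisc → ℂ} (c : ℂ) (hf : IsDiscAnalytic f) :
    IsDiscAnalytic (c • f) := by
  unfold IsDiscAnalytic
  rw [discExtend_smul]
  exact DifferentiableOn.const_smul hf c

/-- The Hardy space `H²` as a linear space of functions on the disk: the analytic functions with
bounded integral means. -/
def hardySubmodule : Submodule ℂ (UnitDisc → ℂ) where
  carrier := {f | IsDiscAnalytic f ∧ ∃ C : ℝ, ∀ r ∈ Set.Ioo (0 : ℝ) 1, integralMean f r ≤ C}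
  zero_mem' := by
    refine ⟨?_, 0, fun r _ => ?_⟩
    · simp only [IsDiscAnalytic, discExtend_zero]
      exact differentiableOn_const 0
    · simp [integralMean, discExtend_zero, Real.circleAverage]
  add_mem' := by
    rintro f g ⟨hf, C, hC⟩ ⟨hg, D, hD⟩
    refine ⟨hf.add hg, 2 * C + 2 * D, fun r hr => ?_⟩
    have hfi := hf.circleIntegrable_sq hr
    have hgi := hg.circleIntegrable_sq hr
    calc integralMean (f + g) r
        ≤ Real.circleAverage
          ((2 : ℝ) • (fun z => ‖discExtend f z‖ ^ 2) + (2 : ℝ) • fun z => ‖discExtend g z‖ ^ 2)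
          0 r := by
          refine Real.circleAverage_mono ((hf.add hg).circleIntegrable_sq hr)
            ((hfi.const_smul (a := (2 : ℝ))).add (hgi.const_smul (a := (2 : ℝ)))) fun z _ => ?_
          simp only [discExtend_add, Pi.add_apply, Pi.smul_apply, smul_eq_mul]
          nlinarith [norm_add_le (discExtend f z) (discExtend g z), norm_nonneg
            (discExtend f z + discExtend g z), sq_nonneg (‖discExtend f z‖ - ‖discExtend g z‖)]
      _ = 2 * integralMean f r + 2 * integralMean g r := by
          rw [Real.circleAverage_add (hfi.const_smul (a := (2 : ℝ)))
            (hgi.const_smul (a := (2 : ℝ))), Real.circleAverage_smul, Real.circleAverage_smul]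
          rfl
      _ ≤ 2 * C + 2 * D := by linarith [hC r hr, hD r hr]
  smul_mem' := by
    rintro c f ⟨hf, C, hC⟩
    refine ⟨hf.smul c, ‖c‖ ^ 2 * C, fun r hr => ?_⟩
    have : integralMean (c • f) r = ‖c‖ ^ 2 * integralMean f r := by
      unfold integralMean
      rw [← smul_eq_mul, ← Real.circleAverage_smul]
      congr 1
      ext z
      simp [discExtend_smul, mul_pow]
    rw [this]
    exact mul_le_mul_of_nonneg_left (hC r hr) (by positivity)

theorem hasSum_taylorCoeff {f : UnitDisc → ℂ} (hf : IsDiscAnalytic f) {z : ℂ} (hz : ‖z‖ < 1) :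
    HasSum (fun n => taylorCoeff f n * z ^ n) (discExtend f z) := by
  have h := Complex.hasSum_taylorSeries_on_ball (c := 0) (r := 1) hf (by simpa using hz)
  refine h.congr_fun fun n => ?_
  simp [taylorCoeff]
  ring

/-- Parseval's identity on the circle of radius `r`. -/
theorem hasSum_integralMean {f : UnitDisc → ℂ} (hf : IsDiscAnalytic f) {r : ℝ}
    (hr : r ∈ Set.Ioo (0 : ℝ) 1) :
    HasSum (fun n => ‖taylorCoeff f n‖ ^ 2 * r ^ (2 * n)) (integralMean f r) := by
  let p : ℕ → Polynomial ℂ := fun N =>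
    ∑ n ∈ Finset.range N, Polynomial.monomial n (taylorCoeff f n * (r : ℂ) ^ n)
  have hcoeff : ∀ N n, (p N).coeff n =
      if n < N then taylorCoeff f n * (r : ℂ) ^ n else 0 := by
    intro N n
    simp [p, Polynomial.finsetSum_coeff, Polynomial.coeff_monomial]
  have hsum : ∀ N, ∑ n ∈ Finset.range N, ‖taylorCoeff f n‖ ^ 2 * r ^ (2 * n) =
      Real.circleAverage (fun z => ‖(p N).eval z‖ ^ 2) 0 1 := by
    intro N
    rw [← Polynomial.sum_sq_norm_coeff_eq_circleAverage]
    have hsub : (p N).support ⊆ Finset.range N := by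
      intro n hn
      rw [Polynomial.mem_support_iff, hcoeff] at hn
      simp only [Finset.mem_range]
      by_contra h
      simp [h] at hn
    rw [Finset.sum_subset hsub fun n _ hn => by
      rw [Polynomial.notMem_support_iff.1 hn]; simp]
    refine Finset.sum_congr rfl fun n hn => ?_
    rw [hcoeff, if_pos (Finset.mem_range.1 hn), norm_mul, norm_pow, Complex.norm_real,
      Real.norm_of_nonneg hr.1.le, mul_pow, ← pow_mul, mul_comm n 2]
  have hr1 : ‖(r : ℂ)‖ < 1 := by
    rw [Complex.norm_real, Real.norm_of_nonneg hr.1.le]; exact hr.2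
  have habs : Summable fun n => ‖taylorCoeff f n * (r : ℂ) ^ n‖ :=
    (hasSum_taylorCoeff hf hr1).summable.norm
  have heval : ∀ N z, (p N).eval z =
      ∑ n ∈ Finset.range N, taylorCoeff f n * ((r : ℂ) * z) ^ n := by
    intro N z
    simp [p, Polynomial.eval_finsetSum, mul_pow, mul_assoc]
  have hlim : Filter.Tendsto
      (fun N => Real.circleAverage (fun z => ‖(p N).eval z‖ ^ 2) 0 1) Filter.atTop
      (𝓝 (integralMean f r)) := by
    rw [integralMean, Real.circleAverage_eq_circleAverage_zero_one]
    unfold Real.circleAverage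
    refine Filter.Tendsto.const_smul ?_ _
    refine intervalIntegral.tendsto_integral_filter_of_dominated_convergence
      (fun _ => (∑' n, ‖taylorCoeff f n * (r : ℂ) ^ n‖) ^ 2) ?_ ?_ ?_ ?_
    · refine Filter.Eventually.of_forall fun N => ?_
      refine Continuous.aestronglyMeasurable ?_
      exact (((p N).continuous.comp (_root_.continuous_circleMap 0 1)).norm).pow 2
    · refine Filter.Eventually.of_forall fun N => Filter.Eventually.of_forall fun θ _ => ?_
      rw [norm_pow, norm_norm]
      refine pow_le_pow_left₀ (norm_nonneg _) ?_ 2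
      rw [heval]
      refine (norm_sum_le _ _).trans ?_
      refine le_trans (le_of_eq ?_) (habs.sum_le_tsum (Finset.range N) fun _ _ => norm_nonneg _)
      refine Finset.sum_congr rfl fun n _ => ?_
      simp [mul_pow]
    · exact intervalIntegrable_const
    · refine Filter.Eventually.of_forall fun θ _ => ?_
      refine Filter.Tendsto.pow (Filter.Tendsto.norm ?_) 2
      simp only [heval, add_zero]
      refine (hasSum_taylorCoeff hf ?_).tendsto_sum_nat
      simpa using hr1
  have hsm : Summable fun n => ‖taylorCoeff f n‖ ^ 2 * r ^ (2 * n) := by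
    refine summable_of_sum_range_le (c := (∑' n, ‖taylorCoeff f n * (r : ℂ) ^ n‖) ^ 2)
      (fun n => mul_nonneg (by positivity) (pow_nonneg hr.1.le _)) fun N => ?_
    have hle : ∑ n ∈ Finset.range N, ‖taylorCoeff f n‖ ^ 2 * r ^ (2 * n) ≤
        (∑ n ∈ Finset.range N, ‖taylorCoeff f n * (r : ℂ) ^ n‖) ^ 2 := by
      refine le_trans (le_of_eq (Finset.sum_congr rfl fun n _ => ?_))
        (Finset.sum_sq_le_sq_sum_of_nonneg fun n _ => norm_nonneg _)
      rw [norm_mul, norm_pow, Complex.norm_real, Real.norm_of_nonneg hr.1.le, mul_pow, ← pow_mul,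
        mul_comm n 2]
    exact hle.trans (pow_le_pow_left₀ (Finset.sum_nonneg fun _ _ => norm_nonneg _)
      (habs.sum_le_tsum _ fun _ _ => norm_nonneg _) 2)
  refine (hsm.hasSum_iff_tendsto_nat).2 ?_
  simpa only [hsum] using hlim

theorem summable_sq_taylorCoeff {f : UnitDisc → ℂ} (hf : f ∈ hardySubmodule) :
    Summable fun n => ‖taylorCoeff f n‖ ^ 2 := by
  obtain ⟨hfa, C, hC⟩ := hf
  refine summable_of_sum_range_le (c := C) (fun n => by positivity) fun N => ?_
  have hcont : Filter.Tendsto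
      (fun r : ℝ => ∑ n ∈ Finset.range N, ‖taylorCoeff f n‖ ^ 2 * r ^ (2 * n)) (𝓝[<] 1)
      (𝓝 (∑ n ∈ Finset.range N, ‖taylorCoeff f n‖ ^ 2 * (1 : ℝ) ^ (2 * n))) := by
    refine Filter.Tendsto.mono_left (Continuous.tendsto (by fun_prop) 1) nhdsWithin_le_nhds
  simp only [one_pow, mul_one] at hcont
  refine le_of_tendsto hcont ?_
  filter_upwards [Ioo_mem_nhdsLT (zero_lt_one (α := ℝ))] with r hr
  refine le_trans ?_ (hC r hr)
  exact sum_le_hasSum _ (fun n _ => mul_nonneg (by positivity) (pow_nonneg hr.1.le _))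
    (hasSum_integralMean hfa hr)

theorem taylorCoeff_add {f g : UnitDisc → ℂ} (hf : IsDiscAnalytic f) (hg : IsDiscAnalytic g)
    (n : ℕ) : taylorCoeff (f + g) n = taylorCoeff f n + taylorCoeff g n := by
  have h0 : Metric.ball (0 : ℂ) 1 ∈ 𝓝 0 := Metric.ball_mem_nhds _ one_pos
  unfold taylorCoeff
  rw [discExtend_add, iteratedDeriv_add (DifferentiableOn.analyticAt hf h0).contDiffAt
    (DifferentiableOn.analyticAt hg h0).contDiffAt, mul_add]

theorem taylorCoeff_smul {f : UnitDisc → ℂ} (c : ℂ) (hf : IsDiscAnalytic f)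
    (n : ℕ) : taylorCoeff (c • f) n = c * taylorCoeff f n := by
  have h0 : Metric.ball (0 : ℂ) 1 ∈ 𝓝 0 := Metric.ball_mem_nhds _ one_pos
  unfold taylorCoeff
  rw [discExtend_smul, iteratedDeriv_const_smul (DifferentiableOn.analyticAt hf h0).contDiffAt,
    smul_eq_mul]
  ring

/-- The Hardy space `H²` of the unit disk. It is kept apart from `hardySubmodule` so that it carries
the norm topology and not the topology of pointwise convergence. -/
def HardySpace : Type := hardySubmodule

instance : AddCommGroup HardySpace := inferInstanceAs (AddCommGroup hardySubmodule)

instance : Module ℂ HardySpace := inferInstanceAs (Module ℂ hardySubmodule)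

/-- A member of `H²` as a function on the disk. -/
def HardySpace.toFun (f : HardySpace) : UnitDisc → ℂ := Subtype.val f

instance : CoeFun HardySpace fun _ => UnitDisc → ℂ := ⟨HardySpace.toFun⟩

theorem HardySpace.mem (f : HardySpace) : HardySpace.toFun f ∈ hardySubmodule := Subtype.property f

theorem HardySpace.toFun_add (f g : HardySpace) : (f + g).toFun = f.toFun + g.toFun := rfl

theorem HardySpace.toFun_smul (c : ℂ) (f : HardySpace) : (c • f).toFun = c • f.toFun := rfl

theorem HardySpace.toFun_zero : (0 : HardySpace).toFun = 0 := rfl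

theorem HardySpace.ext {f g : HardySpace} (h : ∀ z, f z = g z) : f = g :=
  Subtype.ext (funext h)

/-- The sequence of Taylor coefficients of a member of `H²`, in `ℓ²`. -/
def HardySpace.coeffs (f : HardySpace) : lp (fun _ : ℕ => ℂ) 2 :=
  ⟨taylorCoeff f, memℓp_gen (by simpa using summable_sq_taylorCoeff f.mem)⟩

/-- The inner product of `H²`, `⟨f, g⟩ = ∑ aₙ conj bₙ` in terms of the Taylor coefficients of `f` and
`g`. Following Mathlib, `⟪g, f⟫` is linear in its second argument `f`. -/
@[reducible] def HardySpace.innerCore : InnerProductSpace.Core ℂ HardySpace where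
  inner g f := ∑' n, taylorCoeff f n * conj (taylorCoeff g n)
  conj_inner_symm f g := inner_conj_symm f.coeffs g.coeffs
  re_inner_nonneg f := inner_self_nonneg (𝕜 := ℂ) (x := f.coeffs)
  add_left f g h := by
    have hadd : (f + g).coeffs = f.coeffs + g.coeffs := by
      ext n
      exact taylorCoeff_add f.mem.1 g.mem.1 n
    have := inner_add_left (𝕜 := ℂ) f.coeffs g.coeffs h.coeffs
    rw [← hadd] at this
    exact this
  smul_left f g c := by
    have hsmul : (c • f).coeffs = c • f.coeffs := by
      ext n
      exact taylorCoeff_smul c f.mem.1 n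
    have := inner_smul_left (𝕜 := ℂ) f.coeffs g.coeffs c
    rw [← hsmul] at this
    exact this
  definite f hf := by
    have h0 : f.coeffs = 0 := inner_self_eq_zero (𝕜 := ℂ) |>.1 hf
    refine HardySpace.ext fun z => ?_
    have hz := hasSum_taylorCoeff f.mem.1 z.norm_lt_one
    have hc : ∀ n, taylorCoeff f n = 0 := fun n => congrArg (fun a : lp (fun _ : ℕ => ℂ) 2 => a n) h0
    simp only [hc, zero_mul, discExtend_coe] at hz
    exact hz.unique hasSum_zero

instance : NormedAddCommGroup HardySpace := HardySpace.innerCore.toNormedAddCommGroup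

instance : InnerProductSpace ℂ HardySpace := InnerProductSpace.ofCore HardySpace.innerCore.toCore

theorem HardySpace.inner_def (f g : HardySpace) :
    ⟪g, f⟫_ℂ = ∑' n, taylorCoeff f n * conj (taylorCoeff g n) := rfl

/-- The norm of `H²` is the limit of the integral means. -/
theorem HardySpace.tendsto_integralMean (f : HardySpace) :
    Filter.Tendsto (fun r => integralMean f r ^ (1 / 2 : ℝ)) (𝓝[<] 1) (𝓝 ‖f‖) := by
  have hsq : ‖f‖ ^ 2 = ∑' n, ‖taylorCoeff f n‖ ^ 2 := by
    rw [← Complex.ofReal_inj, Complex.ofReal_pow, Complex.ofReal_tsum]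
    have h := inner_self_eq_norm_sq_to_K (𝕜 := ℂ) f
    rw [HardySpace.inner_def] at h
    refine h.symm.trans (tsum_congr fun n => ?_)
    rw [Complex.mul_conj, Complex.normSq_eq_norm_sq]
  have hs := summable_sq_taylorCoeff f.mem
  have hlim : Filter.Tendsto (fun r : ℝ => integralMean f r) (𝓝[<] 1) (𝓝 (‖f‖ ^ 2)) := by
    have h1 : Filter.Tendsto (fun r : ℝ => ∑' n, ‖taylorCoeff f n‖ ^ 2 * r ^ (2 * n)) (𝓝[<] 1)
        (𝓝 (∑' n, ‖taylorCoeff f n‖ ^ 2)) := by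
      refine tendsto_tsum_of_dominated_convergence hs (fun n => ?_) ?_
      · have : Filter.Tendsto (fun r : ℝ => ‖taylorCoeff f n‖ ^ 2 * r ^ (2 * n)) (𝓝[<] 1)
            (𝓝 (‖taylorCoeff f n‖ ^ 2 * 1 ^ (2 * n))) :=
          Filter.Tendsto.mono_left (Continuous.tendsto (by fun_prop) 1) nhdsWithin_le_nhds
        simpa using this
      · filter_upwards [Ioo_mem_nhdsLT (zero_lt_one (α := ℝ))] with r hr n
        rw [norm_mul, norm_pow, norm_norm, norm_pow, Real.norm_of_nonneg hr.1.le]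
        exact mul_le_of_le_one_right (by positivity) (pow_le_one₀ hr.1.le hr.2.le)
    rw [hsq]
    refine h1.congr' ?_
    filter_upwards [Ioo_mem_nhdsLT (zero_lt_one (α := ℝ))] with r hr
    exact (hasSum_integralMean f.mem.1 hr).tsum_eq
  have := hlim.rpow_const (p := (1 / 2 : ℝ)) (Or.inr (by norm_num))
  rwa [← Real.sqrt_eq_rpow, Real.sqrt_sq (norm_nonneg f)] at this

/-- The Blaschke factor with zero `a`: `b₀(z) = z`, and otherwise
`(|a| / a) (a - z) / (1 - conj a z)`. -/
def blaschkeFactor (a z : UnitDisc) : ℂ :=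
  if (a : ℂ) = 0 then z else (‖(a : ℂ)‖ / a) * ((a - z) / (1 - conj (a : ℂ) * z))

/-- `u` is a Blaschke product with zeros `lam i`, repeated according to multiplicity: the zeros satisfy
the Blaschke condition and `u` is a unimodular constant times the product of their Blaschke
factors. -/
def IsBlaschkeProduct {ι : Type*} (u : UnitDisc → ℂ) (lam : ι → UnitDisc) : Prop :=
  Summable (fun i => 1 - ‖(lam i : ℂ)‖) ∧
    ∃ c : ℂ, ‖c‖ = 1 ∧ ∀ z, u z = c * ∏' i, blaschkeFactor (lam i) z

/-- `uH²`, the members of `H²` of the form `u h` with `h ∈ H²`. -/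
def mulHardy (u : UnitDisc → ℂ) : Submodule ℂ HardySpace where
  carrier := {f | ∃ h : HardySpace, ∀ z, f z = u z * h z}
  zero_mem' := ⟨0, fun z => by simp [HardySpace.toFun_zero]⟩
  add_mem' := by
    rintro f g ⟨h, hh⟩ ⟨k, hk⟩
    exact ⟨h + k, fun z => by simp [HardySpace.toFun_add, hh, hk, mul_add]⟩
  smul_mem' := by
    rintro c f ⟨h, hh⟩
    exact ⟨c • h, fun z => by simp [HardySpace.toFun_smul, hh, mul_left_comm]⟩

/-- The space `𝒦_u`, the orthogonal complement of `uH²` in `H²`. -/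
def modelSpace (u : UnitDisc → ℂ) : Submodule ℂ HardySpace := (mulHardy u)ᗮ

/-- The function `k_a(z) = (1 - conj (u a) u z) / (1 - conj a z)`, the reproducing kernel of `𝒦_u` at
`a` when `u` is inner. -/
def modelKernel (u : UnitDisc → ℂ) (a z : UnitDisc) : ℂ :=
  (1 - conj (u a) * u z) / (1 - conj (a : ℂ) * z)

theorem norm_conj_mul_lt_one (a : UnitDisc) {z : ℂ} (hz : ‖z‖ < 1) : ‖conj (a : ℂ) * z‖ < 1 := by
  rw [norm_mul, Complex.norm_conj]
  exact mul_lt_one_of_nonneg_of_lt_one_left (norm_nonneg _) a.norm_lt_one hz.le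

theorem cauchyKernel_mem (a : UnitDisc) :
    (fun z : UnitDisc => 1 / (1 - conj (a : ℂ) * z)) ∈ hardySubmodule := by
  have hpos : 0 < 1 - ‖(a : ℂ)‖ := sub_pos.2 a.norm_lt_one
  have hlow : ∀ z : ℂ, ‖z‖ < 1 → 1 - ‖(a : ℂ)‖ ≤ ‖1 - conj (a : ℂ) * z‖ := by
    intro z hz
    have h1 := norm_sub_norm_le (1 : ℂ) (conj (a : ℂ) * z)
    rw [norm_one, norm_mul, Complex.norm_conj] at h1
    nlinarith [norm_nonneg (a : ℂ)]
  have han : IsDiscAnalytic (fun z : UnitDisc => 1 / (1 - conj (a : ℂ) * z)) := by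
    have hd : DifferentiableOn ℂ (fun z : ℂ => 1 / (1 - conj (a : ℂ) * z)) (Metric.ball 0 1) := by
      refine DifferentiableOn.div (by fun_prop) (by fun_prop) fun z hz h0 => ?_
      have := hlow z (by simpa using hz)
      rw [h0, norm_zero] at this
      linarith
    refine hd.congr fun z hz => ?_
    rw [discExtend_of_lt _ (by simpa using hz)]
    rfl
  refine ⟨han, ((1 - ‖(a : ℂ)‖)⁻¹) ^ 2, fun r hr => ?_⟩
  refine Real.circleAverage_mono_on_of_le_circle (han.circleIntegrable_sq hr) fun z hz => ?_
  have hz1 : ‖z‖ < 1 := by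
    have : ‖z‖ = r := by simpa [abs_of_pos hr.1] using hz
    rw [this]; exact hr.2
  refine pow_le_pow_left₀ (norm_nonneg _) ?_ 2
  rw [discExtend_of_lt _ hz1, UnitDisc.coe_mk, one_div, norm_inv]
  exact inv_anti₀ hpos (hlow z hz1)

/-- The Cauchy kernel `z ↦ 1 / (1 - conj a z)` as a member of `H²`. -/
def cauchyKernel (a : UnitDisc) : HardySpace :=
  ⟨fun z : UnitDisc => 1 / (1 - conj (a : ℂ) * z), cauchyKernel_mem a⟩

/-- `f` extends continuously to the closed unit disk, and the values of the extension on the unit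
circle form an infinitely differentiable function. -/
def IsContinuousWithSmoothBoundary (f : UnitDisc → ℂ) : Prop :=
  ∃ F : ℂ → ℂ, ContinuousOn F (Metric.closedBall 0 1) ∧ (∀ z : UnitDisc, F z = f z) ∧
    ContMDiff (𝓡 1) 𝓘(ℝ, ℂ) ∞ fun ζ : Circle => F ζ

end

end ModelSpace

/-! The Cauchy kernels are the reproducing kernels of `H²`, so `f` is orthogonal to all `k_{λᵢ}`
exactly when it vanishes at all `λᵢ`; both density claims reduce to showing that such an `f` lies
in `uH²`.

A zero `a` of `f` is divided out by Hilbert space geometry. Multiplication by `z` is an isometry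
`S`, so multiplication by `z - a` has closed range, and testing against Cauchy kernels shows that
only the multiples of `k_a` are orthogonal to it: hence `f = (S - a) g`. As
`‖(S - a) g‖ = ‖(1 - ā S) g‖`, the quotient of `f` by the Blaschke factor of `a` has the norm of
`f`. Dividing by longer and longer finite partial products of `u` therefore gives a bounded net of
quotients, and a weak cluster point of this net is the quotient of `f` by `u`. -/

namespace ModelSpace

open Complex Filter

theorem isClosed_range_sub_smul_id {𝕜 E : Type*} [NontriviallyNormedField 𝕜]
    [NormedAddCommGroup E] [NormedSpace 𝕜 E] [CompleteSpace E] (S : E →ₗᵢ[𝕜] E) {c : 𝕜}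
    (hc : ‖c‖ < 1) :
    IsClosed ((S.toContinuousLinearMap - c • ContinuousLinearMap.id 𝕜 E).range : Set E) := by
  set T := S.toContinuousLinearMap - c • ContinuousLinearMap.id 𝕜 E
  have hpos : 0 < 1 - ‖c‖ := sub_pos.2 hc
  have hbound : ∀ x, ‖x‖ ≤ (1 - ‖c‖)⁻¹ * ‖T x‖ := fun x => by
    rw [le_inv_mul_iff₀ hpos]
    calc (1 - ‖c‖) * ‖x‖ = ‖S x‖ - ‖c • x‖ := by rw [S.norm_map, norm_smul]; ring
      _ ≤ ‖S x - c • x‖ := norm_sub_norm_le _ _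
  exact (T.antilipschitz_of_bound (K := ⟨(1 - ‖c‖)⁻¹, (inv_pos.2 hpos).le⟩) hbound).isClosed_range
    T.uniformContinuous

section InnerProductSpace

variable {𝕜 E : Type*} [RCLike 𝕜] [NormedAddCommGroup E] [InnerProductSpace 𝕜 E]

theorem norm_sub_smul_eq_norm_sub_conj_smul {x y : E} (h : ‖x‖ = ‖y‖) (c : 𝕜) :
    ‖y - c • x‖ = ‖x - conj c • y‖ := by
  have hinner : ⟪y, c • x⟫_𝕜 = conj ⟪x, conj c • y⟫_𝕜 := by
    rw [inner_conj_symm, inner_smul_left, RCLike.conj_conj, inner_smul_right]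
  rw [← sq_eq_sq₀ (norm_nonneg _) (norm_nonneg _), norm_sub_sq (𝕜 := 𝕜), norm_sub_sq (𝕜 := 𝕜),
    hinner, RCLike.conj_re, norm_smul, norm_smul, RCLike.norm_conj, h]

theorem mem_orthogonal_span_iff {s : Set E} {x : E} :
    x ∈ (Submodule.span 𝕜 s)ᗮ ↔ ∀ y ∈ s, ⟪x, y⟫_𝕜 = 0 := by
  rw [← Submodule.span_singleton_le_iff_mem, ← Submodule.isOrtho_iff_le, Submodule.isOrtho_span]
  simp only [Set.mem_singleton_iff, forall_eq]

theorem exists_tendsto_inner_of_norm_le [CompleteSpace E] {α : Type*} (𝒰 : Ultrafilter α)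
    {h : α → E} {R : ℝ} (hR : ∀ s, ‖h s‖ ≤ R) :
    ∃ k : E, ∀ x, Tendsto (fun s => ⟪x, h s⟫_𝕜) 𝒰 (𝓝 ⟪x, k⟫_𝕜) := by
  let φ : α → WeakDual 𝕜 E := fun s => StrongDual.toWeakDual (InnerProductSpace.toDual 𝕜 E (h s))
  have hball : ∀ s, φ s ∈ WeakDual.toStrongDual ⁻¹' Metric.closedBall (0 : StrongDual 𝕜 E) R :=
    fun s => mem_closedBall_zero_iff.2
      (((InnerProductSpace.toDual 𝕜 E).norm_map (h s)).trans_le (hR s))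
  obtain ⟨ψ, -, hψ⟩ := (WeakDual.isCompact_closedBall (0 : StrongDual 𝕜 E) R).ultrafilter_le_nhds
    (𝒰.map φ) (le_principal_iff.2 (mem_map.2 (Eventually.of_forall hball)))
  refine ⟨(InnerProductSpace.toDual 𝕜 E).symm (WeakDual.toStrongDual ψ), fun x => ?_⟩
  have hlim : Tendsto (fun s => ⟪h s, x⟫_𝕜) 𝒰 (𝓝 (ψ x)) :=
    ((WeakDual.eval_continuous x).tendsto ψ).comp hψ
  have hψx : ⟪(InnerProductSpace.toDual 𝕜 E).symm (WeakDual.toStrongDual ψ), x⟫_𝕜 = ψ x :=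
    InnerProductSpace.toDual_symm_apply
  rw [← inner_conj_symm, hψx]
  simpa only [Function.comp_def, inner_conj_symm] using
    (RCLike.continuous_conj.tendsto _).comp hlim

end InnerProductSpace

section PowerSeries

theorem hasFPowerSeriesOnBall_ofScalars_of_hasSum {𝕜 : Type*} [DenselyNormedField 𝕜] {g : 𝕜 → 𝕜}
    {a : ℕ → 𝕜} {c : 𝕜} {r : ENNReal} (hr : 0 < r)
    (h : ∀ z ∈ Metric.eball 0 r, HasSum (fun n => a n * z ^ n) (g (c + z))) :
    HasFPowerSeriesOnBall g (FormalMultilinearSeries.ofScalars 𝕜 a) c r where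
  r_le := by
    refine ENNReal.le_of_forall_nnreal_lt fun s hs => ?_
    obtain ⟨t, hst, htr⟩ := ENNReal.lt_iff_exists_nnreal_btwn.1 hs
    obtain ⟨z, hsz, hzt⟩ := NormedField.exists_lt_nnnorm_lt 𝕜 (ENNReal.coe_lt_coe.1 hst)
    have hz : z ∈ Metric.eball 0 r := by
      rw [Metric.mem_eball, edist_zero_right]
      exact (ENNReal.coe_lt_coe.2 hzt).trans htr
    refine (ENNReal.coe_le_coe.2 hsz.le).trans
      (FormalMultilinearSeries.le_radius_of_tendsto _ (l := 0) ?_)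
    simpa only [FormalMultilinearSeries.ofScalars_norm, norm_mul, norm_pow, coe_nnnorm, norm_zero]
      using (h z hz).summable.tendsto_atTop_zero.norm
  r_pos := hr
  hasSum := fun {y} hy => by
    simpa only [FormalMultilinearSeries.ofScalars_apply_eq, smul_eq_mul] using h y hy

variable {f : UnitDisc → ℂ} {a : ℕ → ℂ}

theorem hasFPowerSeriesOnBall_discExtend
    (h : ∀ z : UnitDisc, HasSum (fun n => a n * (z : ℂ) ^ n) (f z)) :
    HasFPowerSeriesOnBall (discExtend f) (FormalMultilinearSeries.ofScalars ℂ a) 0 1 := by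
  refine hasFPowerSeriesOnBall_ofScalars_of_hasSum one_pos fun z hz => ?_
  have hz1 : ‖z‖ < 1 := by
    rwa [← ENNReal.ofReal_one, Metric.eball_ofReal, mem_ball_zero_iff] at hz
  rw [zero_add, discExtend_of_lt f hz1]
  exact h (UnitDisc.mk z hz1)

theorem isDiscAnalytic_of_hasSum
    (h : ∀ z : UnitDisc, HasSum (fun n => a n * (z : ℂ) ^ n) (f z)) : IsDiscAnalytic f := by
  have hd := (hasFPowerSeriesOnBall_discExtend h).differentiableOn
  rwa [← ENNReal.ofReal_one, Metric.eball_ofReal] at hd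

theorem taylorCoeff_eq_of_hasSum
    (h : ∀ z : UnitDisc, HasSum (fun n => a n * (z : ℂ) ^ n) (f z)) : taylorCoeff f = a := by
  have htaylor : ∀ z : UnitDisc, HasSum (fun n => taylorCoeff f n * (z : ℂ) ^ n) (f z) :=
    fun z => discExtend_coe f z ▸ hasSum_taylorCoeff (isDiscAnalytic_of_hasSum h) z.norm_lt_one
  exact FormalMultilinearSeries.ofScalars_series_injective ℂ ℂ
    ((hasFPowerSeriesOnBall_discExtend htaylor).hasFPowerSeriesAt.eq_formalMultilinearSeries
      (hasFPowerSeriesOnBall_discExtend h).hasFPowerSeriesAt)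

theorem mem_hardySubmodule_of_hasSum (ha : Summable fun n => ‖a n‖ ^ 2)
    (h : ∀ z : UnitDisc, HasSum (fun n => a n * (z : ℂ) ^ n) (f z)) : f ∈ hardySubmodule := by
  have hf := isDiscAnalytic_of_hasSum h
  refine ⟨hf, ∑' n, ‖a n‖ ^ 2, fun r hr => hasSum_le (fun n => ?_) (hasSum_integralMean hf hr)
    ha.hasSum⟩
  rw [taylorCoeff_eq_of_hasSum h]
  exact mul_le_of_le_one_right (by positivity) (pow_le_one₀ hr.1.le hr.2.le)

end PowerSeries

noncomputable section

namespace HardySpace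

/-- The isometry of `H²` into `ℓ²` given by the Taylor coefficients. -/
def coeffsIsometry : HardySpace →ₗᵢ[ℂ] lp (fun _ : ℕ => ℂ) 2 :=
  LinearMap.isometryOfInner
    { toFun := coeffs
      map_add' := fun f g => Subtype.ext <| funext <| taylorCoeff_add f.mem.1 g.mem.1
      map_smul' := fun c f => Subtype.ext <| funext <| taylorCoeff_smul c f.mem.1 }
    fun _ _ => rfl

theorem coeffsIsometry_surjective : Function.Surjective coeffsIsometry := by
  intro a
  have hsq : Summable fun n => ‖a n‖ ^ 2 := by
    simpa using (lp.memℓp a).summable (by norm_num)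
  have hsum (z : UnitDisc) : Summable fun n => a n * (z : ℂ) ^ n := by
    refine Summable.of_norm_bounded
      ((summable_geometric_of_lt_one (norm_nonneg _) z.norm_lt_one).mul_left ‖a‖) fun n => ?_
    rw [norm_mul, norm_pow]
    gcongr
    exact lp.norm_apply_le_norm two_ne_zero a n
  exact ⟨⟨_, mem_hardySubmodule_of_hasSum hsq fun z => (hsum z).hasSum⟩,
    Subtype.ext (taylorCoeff_eq_of_hasSum fun z => (hsum z).hasSum)⟩

instance : CompleteSpace HardySpace :=
  (LinearIsometryEquiv.ofSurjective coeffsIsometry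
    coeffsIsometry_surjective).toIsometryEquiv.completeSpace

end HardySpace

section ReproducingKernel

theorem taylorCoeff_cauchyKernel (a : UnitDisc) :
    taylorCoeff (cauchyKernel a) = fun n => conj (a : ℂ) ^ n := by
  refine taylorCoeff_eq_of_hasSum fun z => ?_
  change HasSum _ (1 / (1 - conj (a : ℂ) * z))
  simpa only [← mul_pow, ← one_div] using
    hasSum_geometric_of_norm_lt_one (norm_conj_mul_lt_one a z.norm_lt_one)

theorem inner_cauchyKernel (a : UnitDisc) (f : HardySpace) : ⟪cauchyKernel a, f⟫_ℂ = f a := by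
  have hf := hasSum_taylorCoeff f.mem.1 a.norm_lt_one
  rw [discExtend_coe] at hf
  simp only [HardySpace.inner_def, taylorCoeff_cauchyKernel, map_pow, Complex.conj_conj, hf.tsum_eq]

theorem mem_orthogonal_span_cauchyKernel_iff {ι : Type*} {lam : ι → UnitDisc} {f : HardySpace} :
    f ∈ (Submodule.span ℂ (Set.range fun i => cauchyKernel (lam i)))ᗮ ↔ ∀ i, f (lam i) = 0 := by
  simp only [mem_orthogonal_span_iff, Set.forall_mem_range, inner_eq_zero_symm (x := f),
    inner_cauchyKernel]

theorem one_sub_conj_mul_ne_zero (a : UnitDisc) {z : ℂ} (hz : ‖z‖ ≤ 1) :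
    1 - conj (a : ℂ) * z ≠ 0 := by
  have hlt : ‖conj (a : ℂ) * z‖ < 1 := by
    rw [norm_mul, Complex.norm_conj]
    exact mul_lt_one_of_nonneg_of_lt_one_left (norm_nonneg _) a.norm_lt_one hz
  refine sub_ne_zero.2 fun h => hlt.ne ?_
  rw [← h, norm_one]

end ReproducingKernel

section Shift

theorem discExtend_coe_mul (f : UnitDisc → ℂ) (z : ℂ) :
    discExtend (fun w => w * f w) z = z * discExtend f z := by
  by_cases hz : ‖z‖ < 1 <;> simp [discExtend, hz]

theorem IsDiscAnalytic.coe_mul {f : UnitDisc → ℂ} (hf : IsDiscAnalytic f) :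
    IsDiscAnalytic fun z => z * f z :=
  (differentiableOn_id.mul hf).congr fun z _ => discExtend_coe_mul f z

theorem integralMean_coe_mul (f : UnitDisc → ℂ) (r : ℝ) :
    integralMean (fun z => z * f z) r = r ^ 2 * integralMean f r := by
  rw [integralMean, integralMean, ← smul_eq_mul, ← Real.circleAverage_smul]
  refine Real.circleAverage_congr_sphere fun z hz => ?_
  rw [Pi.smul_apply, smul_eq_mul, discExtend_coe_mul, norm_mul, mul_pow,
    mem_sphere_zero_iff_norm.1 hz, sq_abs]

theorem integralMean_nonneg (f : UnitDisc → ℂ) (r : ℝ) : 0 ≤ integralMean f r :=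
  Real.circleAverage_nonneg_of_nonneg fun _ _ => sq_nonneg _

theorem coe_mul_mem_hardySubmodule {f : UnitDisc → ℂ} (hf : f ∈ hardySubmodule) :
    (fun z : UnitDisc => z * f z) ∈ hardySubmodule := by
  obtain ⟨hfa, C, hC⟩ := hf
  refine ⟨hfa.coe_mul, C, fun r hr => ?_⟩
  rw [integralMean_coe_mul]
  exact (mul_le_of_le_one_left (integralMean_nonneg f r) (pow_le_one₀ hr.1.le hr.2.le)).trans
    (hC r hr)

namespace HardySpace

/-- The shift operator of `H²`, multiplication by the coordinate `z`. -/
def shift : HardySpace →ₗᵢ[ℂ] HardySpace where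
  toFun f := ⟨fun z => z * f z, coe_mul_mem_hardySubmodule f.mem⟩
  map_add' f g := HardySpace.ext fun z => mul_add (z : ℂ) (f z) (g z)
  map_smul' c f := HardySpace.ext fun z => mul_left_comm (z : ℂ) c (f z)
  norm_map' f := by
    refine tendsto_nhds_unique (tendsto_integralMean _) ?_
    have hlim : Tendsto (fun r : ℝ => r * integralMean f r ^ (1 / 2 : ℝ)) (𝓝[<] 1) (𝓝 (1 * ‖f‖)) :=
      (tendsto_id.mono_left nhdsWithin_le_nhds).mul f.tendsto_integralMean
    rw [one_mul] at hlim
    refine hlim.congr' ?_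
    filter_upwards [Ioo_mem_nhdsLT zero_lt_one] with r hr
    change _ = integralMean (fun z => z * f z) r ^ (1 / 2 : ℝ)
    rw [integralMean_coe_mul, ← Real.sqrt_eq_rpow, ← Real.sqrt_eq_rpow,
      Real.sqrt_mul (sq_nonneg r), Real.sqrt_sq hr.1.le]

/-- Multiplication by `z - a` on `H²`. -/
def mulCoordSub (a : ℂ) : HardySpace →L[ℂ] HardySpace :=
  shift.toContinuousLinearMap - a • ContinuousLinearMap.id ℂ HardySpace

theorem mulCoordSub_apply (a : ℂ) (f : HardySpace) (z : UnitDisc) :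
    mulCoordSub a f z = (z - a) * f z := by
  change z * f z - a * f z = (z - a) * f z
  ring

theorem conj_smul_mulCoordSub_cauchyKernel (a : ℂ) (b : UnitDisc) :
    conj (b : ℂ) • mulCoordSub a (cauchyKernel b) =
      (1 - conj (b : ℂ) * a) • cauchyKernel b - cauchyKernel 0 := by
  refine HardySpace.ext fun z => ?_
  have hz := one_sub_conj_mul_ne_zero b z.norm_lt_one.le
  change conj (b : ℂ) * mulCoordSub a (cauchyKernel b) z =
    (1 - conj (b : ℂ) * a) * (1 / (1 - conj (b : ℂ) * z)) -
      1 / (1 - conj ((0 : UnitDisc) : ℂ) * z)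
  rw [mulCoordSub_apply, UnitDisc.coe_zero, map_zero, zero_mul, sub_zero, div_one]
  change conj (b : ℂ) * ((z - a) * (1 / (1 - conj (b : ℂ) * z))) = _
  field_simp
  ring

theorem orthogonal_range_mulCoordSub_le (a : UnitDisc) :
    (mulCoordSub a).rangeᗮ ≤ ℂ ∙ cauchyKernel a := by
  intro x hx
  have hxb (b : UnitDisc) : (1 - conj (a : ℂ) * b) * x b = x 0 := by
    have horth : ⟪conj (b : ℂ) • mulCoordSub a (cauchyKernel b), x⟫_ℂ = 0 := by
      have hmem : mulCoordSub a (cauchyKernel b) ∈ (mulCoordSub (a : ℂ)).range := ⟨_, rfl⟩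
      rw [inner_smul_left, Submodule.inner_right_of_mem_orthogonal hmem hx, mul_zero]
    rw [conj_smul_mulCoordSub_cauchyKernel, inner_sub_left, inner_smul_left, inner_cauchyKernel,
      inner_cauchyKernel, sub_eq_zero] at horth
    simpa [mul_comm] using horth
  refine Submodule.mem_span_singleton.2 ⟨x 0, HardySpace.ext fun b => ?_⟩
  change x 0 * (1 / (1 - conj (a : ℂ) * b)) = x b
  rw [← hxb b, mul_one_div, mul_div_cancel_left₀ _ (one_sub_conj_mul_ne_zero a b.norm_lt_one.le)]

theorem mem_range_mulCoordSub_iff {a : UnitDisc} {f : HardySpace} :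
    f ∈ (mulCoordSub a).range ↔ f a = 0 := by
  refine ⟨?_, fun hf => ?_⟩
  · rintro ⟨g, rfl⟩
    exact (mulCoordSub_apply a g a).trans (by rw [sub_self, zero_mul])
  · have hclosed : IsClosed ((mulCoordSub (a : ℂ)).range : Set HardySpace) :=
      isClosed_range_sub_smul_id shift a.norm_lt_one
    rw [← hclosed.submodule_topologicalClosure_eq, ← Submodule.orthogonal_orthogonal_eq_closure]
    refine Submodule.orthogonal_le (orthogonal_range_mulCoordSub_le a) ?_
    rwa [Submodule.mem_orthogonal_singleton_iff_inner_right, inner_cauchyKernel]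

end HardySpace

end Shift

section BlaschkeFactor

theorem exists_blaschkeFactor_eq_mul (a : UnitDisc) : ∃ κ : ℂ, ‖κ‖ = 1 ∧ ∀ z : UnitDisc,
    blaschkeFactor a z = κ * ((z - a) / (1 - conj (a : ℂ) * z)) := by
  by_cases ha : (a : ℂ) = 0
  · exact ⟨1, norm_one, fun z => by simp [blaschkeFactor, ha]⟩
  · refine ⟨-(‖(a : ℂ)‖ / a), by simp [ha], fun z => ?_⟩
    rw [blaschkeFactor, if_neg ha]
    ring

theorem blaschkeFactor_eq_zero_iff {a z : UnitDisc} : blaschkeFactor a z = 0 ↔ z = a := by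
  obtain ⟨κ, hκ, hb⟩ := exists_blaschkeFactor_eq_mul a
  have hκ0 : κ ≠ 0 := norm_ne_zero_iff.1 (hκ ▸ one_ne_zero)
  rw [hb, mul_eq_zero_iff_left hκ0, div_eq_zero_iff, sub_eq_zero, UnitDisc.coe_inj,
    or_iff_left (one_sub_conj_mul_ne_zero a z.norm_lt_one.le)]

namespace HardySpace

theorem exists_eq_blaschkeFactor_mul {f : HardySpace} {a : UnitDisc} (hfa : f a = 0) :
    ∃ h : HardySpace, ‖h‖ = ‖f‖ ∧ ∀ z, f z = blaschkeFactor a z * h z := by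
  obtain ⟨g, rfl⟩ := mem_range_mulCoordSub_iff.2 hfa
  obtain ⟨κ, hκ, hb⟩ := exists_blaschkeFactor_eq_mul a
  have hκ0 : κ ≠ 0 := norm_ne_zero_iff.1 (hκ ▸ one_ne_zero)
  refine ⟨κ⁻¹ • (g - conj (a : ℂ) • shift g), ?_, fun z => ?_⟩
  · rw [norm_smul, norm_inv, hκ, inv_one, one_mul]
    exact (norm_sub_smul_eq_norm_sub_conj_smul (shift.norm_map g).symm (a : ℂ)).symm
  · have hz := one_sub_conj_mul_ne_zero a z.norm_lt_one.le
    rw [mul_comm (conj _)] at hz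
    refine (mulCoordSub_apply a g z).trans ?_
    change _ = _ * (κ⁻¹ * (g z - conj (a : ℂ) * (z * g z)))
    rw [hb]
    field_simp

theorem exists_eq_prod_blaschkeFactor_mul (s : Finset UnitDisc) {f : HardySpace}
    (hf : ∀ a ∈ s, f a = 0) :
    ∃ h : HardySpace, ‖h‖ = ‖f‖ ∧ ∀ z, f z = (∏ a ∈ s, blaschkeFactor a z) * h z := by
  classical
  induction s using Finset.induction_on with
  | empty => exact ⟨f, rfl, fun z => by rw [Finset.prod_empty, one_mul]⟩
  | insert b s hb ih =>
    obtain ⟨h, hnorm, hfac⟩ := ih fun a ha => hf a (Finset.mem_insert_of_mem ha)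
    have hprod : ∏ a ∈ s, blaschkeFactor a b ≠ 0 := Finset.prod_ne_zero_iff.2 fun a ha h0 =>
      hb (blaschkeFactor_eq_zero_iff.1 h0 ▸ ha)
    have hhb : h b = 0 := by
      have hfb := hf b (Finset.mem_insert_self b s)
      rw [hfac, mul_eq_zero] at hfb
      exact hfb.resolve_left hprod
    obtain ⟨k, hknorm, hkfac⟩ := exists_eq_blaschkeFactor_mul hhb
    refine ⟨k, hknorm.trans hnorm, fun z => ?_⟩
    rw [hfac, hkfac, Finset.prod_insert hb]
    ring

end HardySpace

theorem blaschkeFactor_sub_one {a : UnitDisc} (ha : (a : ℂ) ≠ 0) (z : UnitDisc) :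
    blaschkeFactor a z - 1 =
      -((1 - ‖(a : ℂ)‖) * (1 + ‖(a : ℂ)‖ / a * z) / (1 - conj (a : ℂ) * z)) := by
  have hne := one_sub_conj_mul_ne_zero a z.norm_lt_one.le
  rw [mul_comm (conj _)] at hne
  rw [blaschkeFactor, if_neg ha]
  field_simp
  linear_combination (z : ℂ) * Complex.conj_mul' (a : ℂ)

theorem one_sub_norm_le_norm_one_sub_conj_mul (a : UnitDisc) (z : ℂ) :
    1 - ‖z‖ ≤ ‖1 - conj (a : ℂ) * z‖ := by
  have hmul : ‖conj (a : ℂ) * z‖ ≤ ‖z‖ := by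
    rw [norm_mul, Complex.norm_conj]
    exact mul_le_of_le_one_left (norm_nonneg z) a.norm_lt_one.le
  calc 1 - ‖z‖ ≤ ‖(1 : ℂ)‖ - ‖conj (a : ℂ) * z‖ := by rw [norm_one]; gcongr
    _ ≤ ‖1 - conj (a : ℂ) * z‖ := norm_sub_norm_le _ _

theorem norm_blaschkeFactor_sub_one_le (a z : UnitDisc) :
    ‖blaschkeFactor a z - 1‖ ≤ 2 / (1 - ‖(z : ℂ)‖) * (1 - ‖(a : ℂ)‖) := by
  have hz : 0 < 1 - ‖(z : ℂ)‖ := sub_pos.2 z.norm_lt_one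
  have ha1 : 0 < 1 - ‖(a : ℂ)‖ := sub_pos.2 a.norm_lt_one
  by_cases ha : (a : ℂ) = 0
  · rw [blaschkeFactor, if_pos ha, ha, norm_zero, sub_zero, mul_one, le_div_iff₀ hz]
    have hsub : ‖(z : ℂ) - 1‖ ≤ 1 + 1 := (norm_sub_le _ _).trans (by rw [norm_one]; linarith)
    nlinarith [norm_nonneg (z : ℂ), norm_nonneg ((z : ℂ) - 1)]
  · have hnum : ‖1 + (‖(a : ℂ)‖ : ℂ) / a * z‖ ≤ 2 := by
      refine (norm_add_le _ _).trans ?_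
      rw [norm_one, norm_mul, norm_div, Complex.norm_real, norm_norm,
        div_self (norm_ne_zero_iff.2 ha), one_mul]
      linarith
    have hone : ‖(1 - ‖(a : ℂ)‖ : ℂ)‖ = 1 - ‖(a : ℂ)‖ := by
      rw [← Complex.ofReal_one, ← Complex.ofReal_sub, Complex.norm_of_nonneg ha1.le]
    rw [blaschkeFactor_sub_one ha, norm_neg, norm_div, norm_mul, hone, mul_comm, mul_div_right_comm]
    gcongr
    exact one_sub_norm_le_norm_one_sub_conj_mul a z

end BlaschkeFactor

section BlaschkeProduct

variable {ι : Type*} {u : UnitDisc → ℂ} {lam : ι → UnitDisc}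

theorem multipliable_blaschkeFactor (h : Summable fun i => 1 - ‖(lam i : ℂ)‖) (z : UnitDisc) :
    Multipliable fun i => blaschkeFactor (lam i) z := by
  have hnorm : Summable fun i => ‖blaschkeFactor (lam i) z - 1‖ :=
    (h.mul_left _).of_nonneg_of_le (fun _ => norm_nonneg _)
      fun i => norm_blaschkeFactor_sub_one_le (lam i) z
  simpa only [add_sub_cancel] using multipliable_one_add_of_summable hnorm

namespace IsBlaschkeProduct

theorem apply_zero (hu : IsBlaschkeProduct u lam) (i : ι) : u (lam i) = 0 := by
  obtain ⟨-, c, -, hc⟩ := hu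
  rw [hc, tprod_of_exists_eq_zero ⟨i, blaschkeFactor_eq_zero_iff.2 rfl⟩, mul_zero]

theorem mem_mulHardy_of_forall_apply_eq_zero (hu : IsBlaschkeProduct u lam)
    (hlam : Function.Injective lam) {f : HardySpace} (hf : ∀ i, f (lam i) = 0) :
    f ∈ mulHardy u := by
  obtain ⟨hsum, c, hc, huc⟩ := hu
  have hc0 : c ≠ 0 := norm_ne_zero_iff.1 (hc ▸ one_ne_zero)
  have hpartial (s : Finset ι) : ∃ h : HardySpace, ‖h‖ = ‖f‖ ∧
      ∀ z, f z = (∏ i ∈ s, blaschkeFactor (lam i) z) * h z := by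
    simpa only [Finset.prod_map, Function.Embedding.coeFn_mk] using
      HardySpace.exists_eq_prod_blaschkeFactor_mul (s.map ⟨lam, hlam⟩) (f := f)
        (by simpa using fun i _ => hf i)
  choose h hnorm hfac using hpartial
  let 𝒰 : Ultrafilter (Finset ι) := Ultrafilter.of atTop
  obtain ⟨k, hk⟩ := exists_tendsto_inner_of_norm_le (𝕜 := ℂ) 𝒰 fun s => (hnorm s).le
  refine ⟨c⁻¹ • k, fun z => ?_⟩
  have hprod : Tendsto (fun s => ∏ i ∈ s, blaschkeFactor (lam i) z) 𝒰
      (𝓝 (∏' i, blaschkeFactor (lam i) z)) :=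
    (multipliable_blaschkeFactor hsum z).hasProd.mono_left (Ultrafilter.of_le atTop)
  have hquot : Tendsto (fun s => h s z) 𝒰 (𝓝 (k z)) := by
    simpa only [inner_cauchyKernel] using hk (cauchyKernel z)
  have hlim : f z = (∏' i, blaschkeFactor (lam i) z) * k z :=
    tendsto_nhds_unique tendsto_const_nhds ((hprod.mul hquot).congr fun s => (hfac s z).symm)
  rw [hlim, huc, HardySpace.toFun_smul, Pi.smul_apply, smul_eq_mul]
  field_simp

theorem mem_mulHardy_iff (hu : IsBlaschkeProduct u lam) (hlam : Function.Injective lam)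
    {f : HardySpace} : f ∈ mulHardy u ↔ ∀ i, f (lam i) = 0 := by
  refine ⟨?_, hu.mem_mulHardy_of_forall_apply_eq_zero hlam⟩
  rintro ⟨h, hh⟩ i
  rw [hh, hu.apply_zero, zero_mul]

theorem topologicalClosure_span_cauchyKernel (hu : IsBlaschkeProduct u lam)
    (hlam : Function.Injective lam) :
    (Submodule.span ℂ (Set.range fun i => cauchyKernel (lam i))).topologicalClosure =
      modelSpace u := by
  have horth : (Submodule.span ℂ (Set.range fun i => cauchyKernel (lam i)))ᗮ = mulHardy u :=
    Submodule.ext fun _ => mem_orthogonal_span_cauchyKernel_iff.trans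
      (hu.mem_mulHardy_iff hlam).symm
  rw [← Submodule.orthogonal_orthogonal_eq_closure, horth, modelSpace]

theorem modelKernel_eq_cauchyKernel (hu : IsBlaschkeProduct u lam) (i : ι) :
    modelKernel u (lam i) = cauchyKernel (lam i) := by
  ext z
  rw [modelKernel, hu.apply_zero, map_zero, zero_mul, sub_zero]
  rfl

end IsBlaschkeProduct

end BlaschkeProduct

section SmoothBoundary

theorem isContinuousWithSmoothBoundary_of_contDiffAt {F : ℂ → ℂ}
    (hF : ∀ z : ℂ, ‖z‖ ≤ 1 → ContDiffAt ℝ ∞ F z) :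
    IsContinuousWithSmoothBoundary fun z => F z := by
  have : Fact (Module.finrank ℝ ℂ = 1 + 1) := finrank_real_complex_fact'
  exact ⟨F, fun z hz => (hF z (mem_closedBall_zero_iff.1 hz)).continuousAt.continuousWithinAt,
    fun _ => rfl, fun ζ => (hF ζ ζ.norm_coe.le).contMDiffAt.comp ζ
      (contMDiff_coe_sphere (E := ℂ) (n := 1) ζ)⟩

theorem isContinuousWithSmoothBoundary_cauchyKernel (a : UnitDisc) :
    IsContinuousWithSmoothBoundary (cauchyKernel a) := by
  refine isContinuousWithSmoothBoundary_of_contDiffAt (F := fun z => 1 / (1 - conj (a : ℂ) * z))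
    fun z hz => ?_
  have hden : ContDiffAt ℝ ∞ (fun z : ℂ => 1 - conj (a : ℂ) * z) z := by fun_prop
  simpa only [one_div] using hden.fun_inv (one_sub_conj_mul_ne_zero a hz)

/-- The members of `H²` that extend continuously to the closed disk with smooth boundary values. -/
def smoothBoundary : Submodule ℂ HardySpace where
  carrier := {f | IsContinuousWithSmoothBoundary f}
  zero_mem' := ⟨0, continuousOn_const, fun _ => rfl, contMDiff_const⟩
  add_mem' := by
    rintro f g ⟨F, hF, hFf, hFs⟩ ⟨G, hG, hGg, hGs⟩
    exact ⟨F + G, hF.add hG, fun z => congrArg₂ (· + ·) (hFf z) (hGg z), hFs.add hGs⟩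
  smul_mem' := by
    rintro c f ⟨F, hF, hFf, hFs⟩
    exact ⟨c • F, hF.const_smul c, fun z => congrArg (c • ·) (hFf z),
      (contDiff_const_smul c).contMDiff.comp hFs⟩

theorem span_cauchyKernel_le_smoothBoundary {ι : Type*} (lam : ι → UnitDisc) :
    Submodule.span ℂ (Set.range fun i => cauchyKernel (lam i)) ≤ smoothBoundary :=
  Submodule.span_le.2 <| Set.range_subset_iff.2 fun i =>
    isContinuousWithSmoothBoundary_cauchyKernel (lam i)

end SmoothBoundary

end

end ModelSpace

theorem mainTheorem9 {ι : Type*} [Countable ι] (u : Complex.UnitDisc → ℂ)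
    (lam : ι → Complex.UnitDisc) (hlam : Function.Injective lam)
    (hu : ModelSpace.IsBlaschkeProduct u lam) :
    (∀ i z, ModelSpace.modelKernel u (lam i) z = ModelSpace.cauchyKernel (lam i) z) ∧
    (Submodule.span ℂ (Set.range fun i => ModelSpace.cauchyKernel (lam i))).topologicalClosure =
      ModelSpace.modelSpace u ∧
    ∃ S : Set ModelSpace.HardySpace, S ⊆ ModelSpace.modelSpace u ∧
      (ModelSpace.modelSpace u : Set ModelSpace.HardySpace) ⊆ closure S ∧
      ∀ f ∈ S, ModelSpace.IsContinuousWithSmoothBoundary f := by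
  have hclosure := hu.topologicalClosure_span_cauchyKernel hlam
  refine ⟨fun i => congrFun (hu.modelKernel_eq_cauchyKernel i), hclosure,
    Submodule.span ℂ (Set.range fun i => ModelSpace.cauchyKernel (lam i)), ?_, ?_,
    ModelSpace.span_cauchyKernel_le_smoothBoundary lam⟩
  · exact hclosure ▸ Submodule.le_topologicalClosure _
  · rw [← hclosure, Submodule.topologicalClosure_coe]
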